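/- For complex numbers $x, q$ and an integer $n \ge 0$ let $(x;q)_n = \prod_{k=0}^{n-1}(1-xq^k)$, and write $(x_1,\dots,x_j;q)_n = (x_1;q)_n\cdots(x_j;q)_n$. Let $a, q$ be complex numbers with $|q|, |qa|, |qa^2| < 1$ and $a \ne 1$. Then all series below converge absolutely, and $$\sum_{n=1}^{\infty} \frac{a^2q^n}{1-a^2q^n} - \sum_{n=1}^{\infty} \frac{aq^n}{1-aq^n} = \sum_{n=1}^{\infty} \frac{(-a)^n q^{n(n+1)/2}}{1-q^n} - \sum_{n=1}^{\infty} \frac{1-aq^{2n}}{1-a}\,\frac{(a;q)_n (q;q)_{2n-1}}{(q;q)_n (a^2q;q)_{2n}}\,(-a^2)^n q^{n(n+1)/2},$$ and, if moreover $a \ne 0$, $$\sum_{n=1}^{\infty} \frac{a^2q^n}{1-a^2q^n} - \sum_{n=1}^{\infty} \frac{aq^n}{1-aq^n} = \frac12 \sum_{n=1}^{\infty} \frac{(1/a^2;q)_n\, a^{2n} q^n}{(q;q)_n (1-q^n)} - \sum_{n=1}^{\infty} \frac{1-aq^{2n}}{1-a}\,\frac{(a,a,-aq,1/a;q)_n (q^2;q^2)_{n-1}\,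 a^n q^n}{(q,q,-1,qa^2;q)_n (a^2q^2;q^2)_n}.$$ -/

import Mathlib

/-- The finite `q`-shifted factorial
`(a; q)_n = (1 - a) (1 - a q) ⋯ (1 - a q ^ (n - 1))`, with `(a; q)_0 = 1`. -/
noncomputable def qPoch (a q : ℂ) (n : ℕ) : ℂ :=
  ∏ k ∈ Finset.range n, (1 - a * q ^ k)

/-!
Write `L(c)` for the Lambert series `∑ c q ^ n / (1 - c q ^ n)`; it satisfies
`L(c) - L(c q) = c q / (1 - c q)`. The other series are treated as functions of the parameter too:
each satisfies a `q`-difference equation, proved by creative telescoping, and is then identified by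
following the orbit `a, a q, a q ^ 2, …` down to `0`, along which sums and limits may be
interchanged because the terms are dominated by one geometric series (`GeomDominated`).

* The series `C(c)` of `binomialTerm` has the same first differences as `L(c)`
  (`sum_binomialTerm_sub`), so `C - L` is constant. As `C(1) = 0`, this gives `C(c) = L(c) - L(1)`
  (`tsum_binomialTerm`).
* The series `D(a)` of `wellPoisedTerm` has the same first differences as `2 L(a) - L(a ^ 2)`
  (`sum_wellPoisedTerm_sub`) and vanishes at `a = 1`, so `D(a) = 2 L(a) - L(a ^ 2) - L(1)`
  (`tsum_wellPoisedTerm`). The second representation is `(C(a ^ 2) - D(a)) / 2`.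
* In the first representation the first difference of the series of `thetaLambertTerm` is a partial
  theta function `θ`, with `θ(a) + a q θ(a q) = -a q`. The series of `gaussTerm` satisfies a
  matching recurrence of second order (`sum_gaussTerm_sub`). Hence the difference `F` of the two
  sides has first differences `E(a) = F(a) - F(a q)` with `E(a) = -a q E(a q)`. Since `F` tends to
  `0` along the orbit and `‖a q‖ < 1`, first `E` and then `F` vanishes (`gaussDefect_eq_zero`).
-/

open Filter Topology Asymptotics

/-! ### Shifted factorials -/

lemma qPoch_zero (c q : ℂ) : qPoch c q 0 = 1 := by simp [qPoch]

lemma qPoch_succ (c q : ℂ) (n : ℕ) : qPoch c q (n + 1) = qPoch c q n * (1 - c * q ^ n) :=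
  Finset.prod_range_succ _ _

lemma one_sub_mul_qPoch (c q : ℂ) (n : ℕ) :
    (1 - c) * qPoch (c * q) q n = qPoch c q n * (1 - c * q ^ n) := by
  rw [← qPoch_succ, qPoch, qPoch, Finset.prod_range_succ', mul_comm]
  simp [pow_succ', mul_assoc]

lemma qPoch_sq (c q : ℂ) (n : ℕ) :
    qPoch (c ^ 2) (q ^ 2) n = qPoch c q n * qPoch (-c) q n := by
  rw [qPoch, qPoch, qPoch, ← Finset.prod_mul_distrib]
  exact Finset.prod_congr rfl fun k _ => by ring

/-- The product `(c - 1) (c - q) ⋯ (c - q ^ (n - 1))`, which is `c ^ n (1 / c; q)_n` for `c ≠ 0`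
and, unlike the latter, depends polynomially on `c`. -/
noncomputable def qFall (c q : ℂ) (n : ℕ) : ℂ :=
  ∏ k ∈ Finset.range n, (c - q ^ k)

lemma qFall_zero (c q : ℂ) : qFall c q 0 = 1 := by simp [qFall]

lemma qFall_succ (c q : ℂ) (n : ℕ) : qFall c q (n + 1) = qFall c q n * (c - q ^ n) :=
  Finset.prod_range_succ _ _

lemma qFall_mul_succ (c q : ℂ) (n : ℕ) :
    qFall (c * q) q (n + 1) = (c * q - 1) * q ^ n * qFall c q n := by
  induction n with
  | zero => simp [qFall]
  | succ n ih => rw [qFall_succ, ih, qFall_succ]; ring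

lemma qFall_one (q : ℂ) (n : ℕ) : qFall 1 q (n + 1) = 0 := by
  rw [qFall, Finset.prod_range_succ']; simp

lemma qPoch_one_div_mul_pow {c : ℂ} (hc : c ≠ 0) (q : ℂ) (n : ℕ) :
    qPoch (1 / c) q n * c ^ n = qFall c q n := by
  induction n with
  | zero => simp [qPoch, qFall]
  | succ n ih => rw [qPoch_succ, qFall_succ, ← ih, pow_succ]; field_simp

lemma one_sub_ne_zero_of_norm_lt {z : ℂ} (hz : ‖z‖ < 1) : 1 - z ≠ 0 := by
  intro h
  rw [← sub_eq_zero.mp h] at hz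
  simp at hz

lemma norm_mul_pow_lt_one {c q : ℂ} (hq : ‖q‖ < 1) (hc : ‖c‖ < 1) (k : ℕ) :
    ‖c * q ^ k‖ < 1 := by
  rw [norm_mul, norm_pow]
  exact (mul_le_of_le_one_right (norm_nonneg _) (pow_le_one₀ (norm_nonneg _) hq.le)).trans_lt hc

lemma one_sub_mul_pow_ne_zero {c q : ℂ} (hq : ‖q‖ < 1) (hc : ‖c‖ < 1) (k : ℕ) :
    1 - c * q ^ k ≠ 0 :=
  one_sub_ne_zero_of_norm_lt (norm_mul_pow_lt_one hq hc k)

lemma qPoch_ne_zero {c q : ℂ} (hq : ‖q‖ < 1) (hc : ‖c‖ < 1) (n : ℕ) : qPoch c q n ≠ 0 :=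
  Finset.prod_ne_zero_iff.mpr fun k _ => one_sub_mul_pow_ne_zero hq hc k

@[fun_prop]
lemma continuous_qPoch {f : ℂ → ℂ} (hf : Continuous f) (q : ℂ) (n : ℕ) :
    Continuous fun c => qPoch (f c) q n := by
  unfold qPoch; fun_prop

@[fun_prop]
lemma continuous_qFall {f : ℂ → ℂ} (hf : Continuous f) (q : ℂ) (n : ℕ) :
    Continuous fun c => qFall (f c) q n := by
  unfold qFall; fun_prop

/-! ### Uniform bounds -/

lemma sum_pow_norm_le {q : ℂ} (hq : ‖q‖ < 1) (n : ℕ) :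
    ∑ k ∈ Finset.range n, ‖q‖ ^ k ≤ (1 - ‖q‖)⁻¹ := by
  rw [← tsum_geometric_of_lt_one (norm_nonneg q) hq]
  exact (summable_geometric_of_lt_one (norm_nonneg q) hq).sum_le_tsum _ fun k _ => by positivity

lemma norm_prod_range_le_exp {q : ℂ} (hq : ‖q‖ < 1) {M : ℝ} (hM : 0 ≤ M) {f : ℕ → ℂ}
    (hf : ∀ k, ‖f k‖ ≤ 1 + M * ‖q‖ ^ k) (n : ℕ) :
    ‖∏ k ∈ Finset.range n, f k‖ ≤ Real.exp (M * (1 - ‖q‖)⁻¹) := by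
  calc ‖∏ k ∈ Finset.range n, f k‖ = ∏ k ∈ Finset.range n, ‖f k‖ := norm_prod _ _
    _ ≤ ∏ k ∈ Finset.range n, Real.exp (M * ‖q‖ ^ k) :=
        Finset.prod_le_prod (fun _ _ => norm_nonneg _) fun k _ =>
          (hf k).trans (by linarith [Real.add_one_le_exp (M * ‖q‖ ^ k)])
    _ = Real.exp (M * ∑ k ∈ Finset.range n, ‖q‖ ^ k) := by
        rw [← Real.exp_sum, Finset.mul_sum]
    _ ≤ _ := by gcongr; exact sum_pow_norm_le hq n

section Bounds

-- The bounds are `IsBigO` statements along `⊤`, hence uniform on the index type `α`. It is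
-- instantiated by `ℕ` and by the product of a disc of parameters with `ℕ`.

variable {α : Type*} {q : ℂ} {u : α → ℂ} {k : α → ℕ} {M : ℝ}

lemma isBigO_qPoch (hq : ‖q‖ < 1) (hu : ∀ p, ‖u p‖ ≤ M) :
    (fun p => qPoch (u p) q (k p)) =O[⊤] fun _ => (1 : ℝ) := by
  refine isBigO_top.mpr ⟨Real.exp (M * (1 - ‖q‖)⁻¹), fun p => ?_⟩
  have hM : 0 ≤ M := (norm_nonneg _).trans (hu p)
  rw [norm_one, mul_one]
  refine norm_prod_range_le_exp hq hM (fun j => ?_) _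
  calc ‖1 - u p * q ^ j‖ ≤ ‖(1 : ℂ)‖ + ‖u p * q ^ j‖ := norm_sub_le _ _
    _ ≤ 1 + M * ‖q‖ ^ j := by
        rw [norm_one, norm_mul, norm_pow]; gcongr; exact hu p

lemma norm_inv_one_sub_le {z : ℂ} {t : ℝ} (hz : ‖z‖ ≤ t) (hM : t ≤ M) (hM1 : M < 1) :
    ‖(1 - z)⁻¹‖ ≤ 1 + t / (1 - M) := by
  have h1 : 1 - t ≤ ‖1 - z‖ := by
    have := norm_sub_norm_le 1 z
    rw [norm_one] at this; linarith
  have ht : 0 ≤ t := (norm_nonneg z).trans hz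
  have h2 : 0 < 1 - t := by linarith
  have h3 : 0 < 1 - M := by linarith
  rw [norm_inv]
  calc ‖1 - z‖⁻¹ ≤ (1 - t)⁻¹ := inv_anti₀ h2 h1
    _ = 1 + t / (1 - t) := by field_simp; ring
    _ ≤ 1 + t / (1 - M) := by gcongr

lemma isBigO_qPoch_inv (hq : ‖q‖ < 1) (hu : ∀ p, ‖u p‖ ≤ M) (hM1 : M < 1) :
    (fun p => (qPoch (u p) q (k p))⁻¹) =O[⊤] fun _ => (1 : ℝ) := by
  refine isBigO_top.mpr ⟨Real.exp (M / (1 - M) * (1 - ‖q‖)⁻¹), fun p => ?_⟩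
  have hM : 0 ≤ M := (norm_nonneg _).trans (hu p)
  have h3 : 0 < 1 - M := by linarith
  rw [norm_one, mul_one, qPoch, ← Finset.prod_inv_distrib]
  refine norm_prod_range_le_exp hq (by positivity) (fun j => ?_) _
  have h1 : ‖u p * q ^ j‖ ≤ M * ‖q‖ ^ j := by
    rw [norm_mul, norm_pow]; gcongr; exact hu p
  have h2 : M * ‖q‖ ^ j ≤ M :=
    mul_le_of_le_one_right hM (pow_le_one₀ (norm_nonneg _) hq.le)
  calc _ ≤ _ := norm_inv_one_sub_le h1 h2 hM1
    _ = _ := by ring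

lemma isBigO_one_sub_inv (hu : ∀ p, ‖u p‖ ≤ M) (hM1 : M < 1) :
    (fun p => (1 - u p)⁻¹) =O[⊤] fun _ => (1 : ℝ) := by
  refine isBigO_top.mpr ⟨1 + M / (1 - M), fun p => ?_⟩
  rw [norm_one, mul_one]
  exact norm_inv_one_sub_le (hu p) le_rfl hM1

lemma isBigO_of_norm_le (hu : ∀ p, ‖u p‖ ≤ M) : u =O[⊤] fun _ => (1 : ℝ) :=
  isBigO_top.mpr ⟨M, fun p => by simpa using hu p⟩

/-- The hypothesis `1 ≤ M` makes `‖q ^ j‖ ≤ M ‖q‖ ^ j`, so that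
`‖c - q ^ j‖ ≤ M (1 + ‖q‖ ^ j)`. -/
lemma isBigO_qFall (hq : ‖q‖ < 1) (hM1 : 1 ≤ M) (hu : ∀ p, ‖u p‖ ≤ M) :
    (fun p => qFall (u p) q (k p)) =O[⊤] fun p => M ^ k p := by
  have hM : 0 < M := by linarith
  refine isBigO_top.mpr ⟨Real.exp (1 * (1 - ‖q‖)⁻¹), fun p => ?_⟩
  have h : qFall (u p) q (k p) =
      (∏ j ∈ Finset.range (k p), ((M : ℂ)⁻¹ * (u p - q ^ j))) * (M : ℂ) ^ k p := by
    rw [Finset.prod_mul_distrib, Finset.prod_const, Finset.card_range, mul_right_comm, ← mul_pow,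
      inv_mul_cancel₀ (by exact_mod_cast hM.ne'), one_pow, one_mul, qFall]
  rw [h, norm_mul, norm_pow, norm_pow, Complex.norm_real]
  gcongr
  refine norm_prod_range_le_exp hq zero_le_one (fun j => ?_) _
  rw [norm_mul, norm_inv, Complex.norm_real, Real.norm_of_nonneg hM.le, inv_mul_le_iff₀ hM]
  calc ‖u p - q ^ j‖ ≤ ‖u p‖ + ‖q ^ j‖ := norm_sub_le _ _
    _ ≤ M + M * ‖q‖ ^ j := by
        rw [norm_pow]
        gcongr
        · exact hu p
        · exact le_mul_of_one_le_left (by positivity) hM1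
    _ = _ := by ring

end Bounds

/-! ### Geometrically dominated families of series -/

/-- A family `t z` of series is geometrically dominated on the disc of radius `ρ` if its terms are
`O(r ^ n)` for some `r < 1`, uniformly in `‖z‖ ≤ ρ`. -/
def GeomDominated (t : ℂ → ℕ → ℂ) (ρ : ℝ) : Prop :=
  ∃ r : ℝ, 0 ≤ r ∧ r < 1 ∧
    (fun p : Metric.closedBall (0 : ℂ) ρ × ℕ => t p.1 p.2) =O[⊤] fun p => r ^ p.2

namespace GeomDominated

variable {t : ℂ → ℕ → ℂ} {ρ : ℝ}

lemma exists_bound (h : GeomDominated t ρ) :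
    ∃ b : ℕ → ℝ, Summable b ∧ ∀ z, ‖z‖ ≤ ρ → ∀ n, ‖t z n‖ ≤ b n := by
  obtain ⟨r, hr0, hr1, hO⟩ := h
  obtain ⟨C, hC⟩ := isBigO_top.mp hO
  refine ⟨fun n => C * ‖r ^ n‖, ?_, fun z hz n => hC (⟨z, by simpa using hz⟩, n)⟩
  simp only [norm_pow, Real.norm_of_nonneg hr0]
  exact (summable_geometric_of_lt_one hr0 hr1).mul_left C

lemma summable (h : GeomDominated t ρ) {z : ℂ} (hz : ‖z‖ ≤ ρ) : Summable (t z) := by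
  obtain ⟨b, hb, hle⟩ := h.exists_bound
  exact hb.of_norm_bounded (hle z hz)

/-- The sum of a dominated family is continuous at `0` along the orbit `z, z q, z q ^ 2, …`. -/
lemma tendsto_tsum (h : GeomDominated t ρ) {z q : ℂ} (hz : ‖z‖ ≤ ρ) (hq : ‖q‖ < 1)
    (hcont : ∀ n, ContinuousAt (fun w => t w n) 0) :
    Tendsto (fun N : ℕ => ∑' n, t (z * q ^ N) n) atTop (𝓝 (∑' n, t 0 n)) := by
  obtain ⟨b, hb, hle⟩ := h.exists_bound
  have hlim : Tendsto (fun N : ℕ => z * q ^ N) atTop (𝓝 0) := by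
    simpa using (tendsto_pow_atTop_nhds_zero_of_norm_lt_one hq).const_mul z
  refine tendsto_tsum_of_dominated_convergence hb (fun n => (hcont n).tendsto.comp hlim)
    (Eventually.of_forall fun N n => hle _ ?_ n)
  rw [norm_mul, norm_pow]
  exact (mul_le_of_le_one_right (norm_nonneg _) (pow_le_one₀ (norm_nonneg _) hq.le)).trans hz

end GeomDominated

/-- A summable series whose partial sums are `r + e n` with `e` geometrically small has
sum `r`. -/
lemma tsum_eq_of_sum_range {f e : ℕ → ℂ} {s : ℂ} {r : ℝ} (hf : Summable f) (hr0 : 0 ≤ r)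
    (hr1 : r < 1) (he : e =O[atTop] fun n => r ^ n)
    (h : ∀ n, ∑ k ∈ Finset.range n, f k = s + e n) : ∑' n, f n = s := by
  have h0 : Tendsto e atTop (𝓝 0) :=
    he.trans_tendsto (tendsto_pow_atTop_nhds_zero_of_lt_one hr0 hr1)
  refine tendsto_nhds_unique hf.hasSum.tendsto_sum_nat ?_
  simp only [h]
  simpa using h0.const_add s

lemma isBigO_comp_pow {q : ℂ} (hq : ‖q‖ < 1) {f : ℂ → ℂ} (hf : Continuous f) :
    (fun n : ℕ => f (q ^ n)) =O[atTop] fun _ => (1 : ℝ) :=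
  ((hf.tendsto 0).comp (tendsto_pow_atTop_nhds_zero_of_norm_lt_one hq)).isBigO_one ℝ

lemma norm_mul_pow_succ_le {q z : ℂ} {ρ : ℝ} (hq : ‖q‖ < 1) (hz : ‖z‖ ≤ ρ) (k : ℕ) :
    ‖z * q ^ (k + 1)‖ ≤ ρ * ‖q‖ := by
  have hρ : 0 ≤ ρ := (norm_nonneg _).trans hz
  rw [norm_mul, norm_pow, pow_succ]
  gcongr
  exact mul_le_of_le_one_left (norm_nonneg _) (pow_le_one₀ (norm_nonneg _) hq.le)

lemma norm_mul_le_of_norm_le {q z : ℂ} {ρ : ℝ} (hq : ‖q‖ < 1) (hz : ‖z‖ ≤ ρ) :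
    ‖z * q‖ ≤ ρ * ‖q‖ := by
  simpa using norm_mul_pow_succ_le hq hz 0

lemma norm_sq_le {z : ℂ} {ρ : ℝ} (hz : ‖z‖ ≤ ρ) : ‖z ^ 2‖ ≤ ρ ^ 2 := by
  rw [norm_pow]; gcongr

lemma isBigO_pow_norm {α : Type*} (q : ℂ) (k : α → ℕ) :
    (fun p => q ^ k p) =O[⊤] fun p => ‖q‖ ^ k p :=
  isBigO_top.mpr ⟨1, fun p => by simp⟩

lemma isBigO_pow_of_norm_le {α : Type*} {u : α → ℂ} {r : ℝ} (hr : 0 ≤ r) (hu : ∀ p, ‖u p‖ ≤ r)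
    (k : α → ℕ) : (fun p => u p ^ k p) =O[⊤] fun p => r ^ k p :=
  isBigO_top.mpr ⟨1, fun p => by
    rw [norm_pow, norm_pow, one_mul, Real.norm_of_nonneg hr]; gcongr; exact hu p⟩

lemma isBigO_pow_succ {α : Type*} (r : ℝ) (k : α → ℕ) :
    (fun p => r ^ (k p + 1)) =O[⊤] fun p => r ^ k p :=
  isBigO_top.mpr ⟨‖r‖, fun p => by rw [pow_succ, norm_mul, mul_comm]⟩

lemma isBigO_pow_one {α : Type*} {q : ℂ} (hq : ‖q‖ < 1) (k : α → ℕ) :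
    (fun p => q ^ k p) =O[⊤] fun _ => (1 : ℝ) :=
  isBigO_of_norm_le (M := 1) fun p => by
    rw [norm_pow]; exact pow_le_one₀ (norm_nonneg _) hq.le

lemma isBigO_one_sub {α : Type*} {u : α → ℂ} {M : ℝ} (hu : ∀ p, ‖u p‖ ≤ M) :
    (fun p => 1 - u p) =O[⊤] fun _ => (1 : ℝ) :=
  isBigO_of_norm_le (M := 1 + M) fun p =>
    (norm_sub_le _ _).trans (by rw [norm_one]; linarith [hu p])

/-! ### The terms of the series -/

/-- The term of index `n + 1` of the Lambert series `∑ c q ^ n / (1 - c q ^ n)`. -/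
noncomputable def lambertTerm (q c : ℂ) (n : ℕ) : ℂ :=
  c * q ^ (n + 1) / (1 - c * q ^ (n + 1))

/-- The term of index `n + 1` of the partial theta series `∑ (-a) ^ n q ^ (n (n + 1) / 2)`. -/
noncomputable def thetaTerm (q a : ℂ) (n : ℕ) : ℂ :=
  (-a) ^ (n + 1) * q ^ ((n + 1) * (n + 1 + 1) / 2)

/-- The term of index `n + 1` of `∑ (-a) ^ n q ^ (n (n + 1) / 2) / (1 - q ^ n)`. -/
noncomputable def thetaLambertTerm (q a : ℂ) (n : ℕ) : ℂ :=
  thetaTerm q a n / (1 - q ^ (n + 1))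

/-- The term of index `n + 1` of the second series of the first representation, with the factor
`1 - a` cancelled, so that it is defined at `a = 1` too. -/
noncomputable def gaussTerm (q a : ℂ) (n : ℕ) : ℂ :=
  (1 - a * q ^ (2 * (n + 1))) * (qPoch (a * q) q n * qPoch q q (2 * n + 1) /
    (qPoch q q (n + 1) * qPoch (a ^ 2 * q) q (2 * n + 2))) *
    (-a ^ 2) ^ (n + 1) * q ^ ((n + 1) * (n + 1 + 1) / 2)

/-- The term of index `n + 1` of `∑ (1 / c; q)_n c ^ n q ^ n / ((q; q)_n (1 - q ^ n))`, written
without the division by `c`. -/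
noncomputable def binomialTerm (q c : ℂ) (n : ℕ) : ℂ :=
  qFall c q (n + 1) * q ^ (n + 1) / (qPoch q q (n + 1) * (1 - q ^ (n + 1)))

/-- Twice the term of index `n + 1` of the second series of the second representation, with
the common factors of numerator and denominator (among them `1 - a`) cancelled. -/
noncomputable def wellPoisedTerm (q a : ℂ) (n : ℕ) : ℂ :=
  (1 - a * q ^ (2 * (n + 1))) * qPoch a q (n + 1) * qFall a q (n + 1) * q ^ (n + 1) /
    ((1 - a * q ^ (n + 1)) * (1 - q ^ (n + 1)) * qPoch q q (n + 1) * qPoch (a ^ 2 * q) q (n + 1))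

lemma triangle_succ (n : ℕ) :
    (n + 1) * (n + 1 + 1) / 2 = n * (n + 1) / 2 + (n + 1) := by
  rw [show (n + 1) * (n + 1 + 1) = n * (n + 1) + (n + 1) * 2 by ring,
    Nat.add_mul_div_right _ _ two_pos]

/-! ### Convergence and continuity of the series -/

section Domination

variable {q : ℂ} {ρ : ℝ}

lemma norm_coe_le (p : Metric.closedBall (0 : ℂ) ρ × ℕ) : ‖(p.1 : ℂ)‖ ≤ ρ :=
  mem_closedBall_zero_iff.mp p.1.2

lemma norm_pow_succ_le (hq : ‖q‖ < 1) (k : ℕ) : ‖q ^ (k + 1)‖ ≤ ‖q‖ := by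
  simpa using norm_mul_pow_succ_le (z := 1) (ρ := 1) hq (by simp) k

lemma geomDominated_lambertTerm (hq : ‖q‖ < 1) (hρq : ρ * ‖q‖ < 1) :
    GeomDominated (lambertTerm q) ρ := by
  refine ⟨‖q‖, norm_nonneg _, hq, ?_⟩
  have h1 := isBigO_of_norm_le (u := fun p : Metric.closedBall (0 : ℂ) ρ × ℕ => (p.1 : ℂ) * q)
    fun p => norm_mul_le_of_norm_le hq (norm_coe_le p)
  have h2 := isBigO_pow_norm q fun p : Metric.closedBall (0 : ℂ) ρ × ℕ => p.2
  have h3 := isBigO_one_sub_inv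
    (u := fun p : Metric.closedBall (0 : ℂ) ρ × ℕ => (p.1 : ℂ) * q ^ (p.2 + 1))
    (fun p => norm_mul_pow_succ_le hq (norm_coe_le p) _) hρq
  refine ((h1.mul h2).mul h3).congr (fun p => ?_) fun p => by ring
  rw [lambertTerm]; ring

lemma isBigO_thetaTerm (hq : ‖q‖ < 1) (hρ : 0 ≤ ρ) :
    (fun p : Metric.closedBall (0 : ℂ) ρ × ℕ => thetaTerm q p.1 p.2) =O[⊤]
      fun p => (ρ * ‖q‖) ^ p.2 := by
  have h1 := isBigO_pow_of_norm_le
    (u := fun p : Metric.closedBall (0 : ℂ) ρ × ℕ => -((p.1 : ℂ) * q)) (r := ρ * ‖q‖)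
    (by positivity) (fun p => by
      rw [norm_neg]; exact norm_mul_le_of_norm_le hq (norm_coe_le p)) fun p => p.2 + 1
  have h2 := isBigO_pow_one hq
    fun p : Metric.closedBall (0 : ℂ) ρ × ℕ => p.2 * (p.2 + 1) / 2
  refine ((h1.trans (isBigO_pow_succ _ _)).mul h2).congr (fun p => ?_) fun p => by ring
  rw [thetaTerm, triangle_succ, pow_add q, neg_mul_eq_neg_mul, mul_pow]; ring

lemma geomDominated_thetaTerm (hq : ‖q‖ < 1) (hρ : 0 ≤ ρ) (hρq : ρ * ‖q‖ < 1) :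
    GeomDominated (thetaTerm q) ρ :=
  ⟨ρ * ‖q‖, by positivity, hρq, isBigO_thetaTerm hq hρ⟩

lemma geomDominated_thetaLambertTerm (hq : ‖q‖ < 1) (hρ : 0 ≤ ρ) (hρq : ρ * ‖q‖ < 1) :
    GeomDominated (thetaLambertTerm q) ρ := by
  refine ⟨ρ * ‖q‖, by positivity, hρq, ?_⟩
  have h1 := isBigO_one_sub_inv
    (u := fun p : Metric.closedBall (0 : ℂ) ρ × ℕ => q ^ (p.2 + 1))
    (fun p => norm_pow_succ_le hq _) hq
  refine ((isBigO_thetaTerm hq hρ).mul h1).congr (fun p => ?_) fun p => by ring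
  rw [thetaLambertTerm]; ring

lemma geomDominated_gaussTerm (hq : ‖q‖ < 1) (hρq2 : ρ ^ 2 * ‖q‖ < 1) :
    GeomDominated (gaussTerm q) ρ := by
  refine ⟨ρ ^ 2 * ‖q‖, by positivity, hρq2, ?_⟩
  let S := Metric.closedBall (0 : ℂ) ρ × ℕ
  have h1 := isBigO_one_sub (u := fun p : S => (p.1 : ℂ) * q ^ (2 * p.2 + 1 + 1))
    (fun p => norm_mul_pow_succ_le hq (norm_coe_le p) _)
  have h2 := isBigO_qPoch (u := fun p : S => (p.1 : ℂ) * q) (k := fun p => p.2) hq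
    fun p => norm_mul_le_of_norm_le hq (norm_coe_le p)
  have h3 := isBigO_qPoch (u := fun _ : S => q) (k := fun p => 2 * p.2 + 1) hq fun p => le_rfl
  have h4 := isBigO_qPoch_inv (u := fun _ : S => q) (k := fun p => p.2 + 1) hq (fun p => le_rfl) hq
  have h5 := isBigO_qPoch_inv (u := fun p : S => (p.1 : ℂ) ^ 2 * q) (k := fun p => 2 * p.2 + 2) hq
    (fun p => norm_mul_le_of_norm_le hq (norm_sq_le (norm_coe_le p))) hρq2
  have h6 := (isBigO_pow_of_norm_le
    (u := fun p : S => -((p.1 : ℂ) ^ 2 * q)) (r := ρ ^ 2 * ‖q‖)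
    (by positivity) (fun p => by
      rw [norm_neg]; exact norm_mul_le_of_norm_le hq (norm_sq_le (norm_coe_le p)))
      fun p => p.2 + 1).trans (isBigO_pow_succ _ _)
  have h7 := isBigO_pow_one hq fun p : S => p.2 * (p.2 + 1) / 2
  refine ((((((h1.mul h2).mul h3).mul h4).mul h5).mul h6).mul h7).congr (fun p => ?_)
    fun p => by ring
  rw [gaussTerm, triangle_succ, pow_add q (_ / 2), neg_mul_eq_neg_mul, mul_pow, mul_add 2 p.2 1]
  ring

lemma geomDominated_binomialTerm (hq : ‖q‖ < 1) (hρq : ρ * ‖q‖ < 1) :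
    GeomDominated (binomialTerm q) ρ := by
  refine ⟨max 1 ρ * ‖q‖, by positivity, ?_, ?_⟩
  · rcases max_cases 1 ρ with h | h <;> simp [h.1, hq, hρq]
  let S := Metric.closedBall (0 : ℂ) ρ × ℕ
  have h1 := isBigO_qFall (u := fun p : S => (p.1 : ℂ)) (k := fun p => p.2 + 1) hq
    (le_max_left 1 ρ) fun p => (norm_coe_le p).trans (le_max_right _ _)
  have h2 := isBigO_pow_norm q fun p : S => p.2 + 1
  have h3 := isBigO_qPoch_inv (u := fun _ : S => q) (k := fun p => p.2 + 1) hq (fun p => le_rfl) hq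
  have h4 := isBigO_one_sub_inv (u := fun p : S => q ^ (p.2 + 1))
    (fun p => norm_pow_succ_le hq _) hq
  refine (((((h1.mul h2).congr_right fun p => (mul_pow _ _ _).symm).trans
    (isBigO_pow_succ _ _)).mul h3).mul h4).congr (fun p => ?_) fun p => by ring
  rw [binomialTerm, div_eq_mul_inv, mul_inv]; ring

lemma geomDominated_wellPoisedTerm (hq : ‖q‖ < 1) (hρq : ρ * ‖q‖ < 1)
    (hρq2 : ρ ^ 2 * ‖q‖ < 1) : GeomDominated (wellPoisedTerm q) ρ := by
  refine ⟨max 1 ρ * ‖q‖, by positivity, ?_, ?_⟩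
  · rcases max_cases 1 ρ with h | h <;> simp [h.1, hq, hρq]
  let S := Metric.closedBall (0 : ℂ) ρ × ℕ
  have h1 := isBigO_qFall (u := fun p : S => (p.1 : ℂ)) (k := fun p => p.2 + 1) hq
    (le_max_left 1 ρ) fun p => (norm_coe_le p).trans (le_max_right _ _)
  have h2 := isBigO_pow_norm q fun p : S => p.2 + 1
  have h3 := isBigO_qPoch_inv (u := fun _ : S => q) (k := fun p => p.2 + 1) hq (fun p => le_rfl) hq
  have h4 := isBigO_one_sub_inv (u := fun p : S => q ^ (p.2 + 1))
    (fun p => norm_pow_succ_le hq _) hq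
  have h5 := isBigO_one_sub (u := fun p : S => (p.1 : ℂ) * q ^ (2 * p.2 + 1 + 1))
    (fun p => norm_mul_pow_succ_le hq (norm_coe_le p) _)
  have h6 := isBigO_qPoch (u := fun p : S => (p.1 : ℂ)) (k := fun p => p.2 + 1) hq norm_coe_le
  have h7 := isBigO_one_sub_inv (u := fun p : S => (p.1 : ℂ) * q ^ (p.2 + 1))
    (fun p => norm_mul_pow_succ_le hq (norm_coe_le p) _) hρq
  have h8 := isBigO_qPoch_inv (u := fun p : S => (p.1 : ℂ) ^ 2 * q) (k := fun p => p.2 + 1) hq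
    (fun p => norm_mul_le_of_norm_le hq (norm_sq_le (norm_coe_le p))) hρq2
  refine (((((((((h1.mul h2).congr_right fun p => (mul_pow _ _ _).symm).trans
    (isBigO_pow_succ _ _)).mul h3).mul h4).mul h5).mul h6).mul h7).mul h8).congr (fun p => ?_)
    fun p => by ring
  rw [wellPoisedTerm, div_eq_mul_inv, mul_inv, mul_inv, mul_inv, mul_add 2 p.2 1]; ring

end Domination

section Continuity

variable {q : ℂ}

lemma continuousAt_lambertTerm (n : ℕ) : ContinuousAt (fun c => lambertTerm q c n) 0 := by
  unfold lambertTerm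
  exact ContinuousAt.div (by fun_prop) (by fun_prop) (by simp)

lemma continuousAt_thetaLambertTerm (n : ℕ) : ContinuousAt (fun a => thetaLambertTerm q a n) 0 := by
  unfold thetaLambertTerm thetaTerm
  fun_prop

lemma continuousAt_binomialTerm (n : ℕ) : ContinuousAt (fun c => binomialTerm q c n) 0 := by
  unfold binomialTerm
  exact Continuous.continuousAt (by fun_prop)

lemma qPoch_zero_left (q : ℂ) (n : ℕ) : qPoch 0 q n = 1 := by simp [qPoch]

lemma continuousAt_gaussTerm (hq : ‖q‖ < 1) (n : ℕ) :
    ContinuousAt (fun a => gaussTerm q a n) 0 := by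
  unfold gaussTerm
  have h : ContinuousAt (fun a : ℂ => qPoch (a * q) q n * qPoch q q (2 * n + 1) /
      (qPoch q q (n + 1) * qPoch (a ^ 2 * q) q (2 * n + 2))) 0 :=
    ContinuousAt.div (Continuous.continuousAt (by fun_prop)) (Continuous.continuousAt (by fun_prop))
      (by simpa [qPoch_zero_left] using qPoch_ne_zero hq hq (n + 1))
  fun_prop

lemma continuousAt_wellPoisedTerm (hq : ‖q‖ < 1) (n : ℕ) :
    ContinuousAt (fun a => wellPoisedTerm q a n) 0 := by
  unfold wellPoisedTerm
  refine ContinuousAt.div (Continuous.continuousAt (by fun_prop))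
    (Continuous.continuousAt (by fun_prop)) ?_
  have h : 1 - q ^ (n + 1) ≠ 0 := by
    simpa [pow_succ'] using one_sub_mul_pow_ne_zero hq hq n
  simpa [qPoch_zero_left, h] using qPoch_ne_zero hq hq (n + 1)

end Continuity

/-! ### Recurrences in the parameter -/

section Recurrences

variable {a c q : ℂ}

lemma norm_mul_self_lt (hq : ‖q‖ < 1) (hc : ‖c * q‖ < 1) : ‖c * q * q‖ < 1 := by
  simpa using norm_mul_pow_lt_one hq hc 1

lemma tsum_lambertTerm_sub (hq : ‖q‖ < 1) (hc : ‖c * q‖ < 1) :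
    ∑' n, lambertTerm q c n - ∑' n, lambertTerm q (c * q) n = c * q / (1 - c * q) := by
  have hs : Summable (lambertTerm q c) :=
    (geomDominated_lambertTerm hq (by rwa [← norm_mul])).summable le_rfl
  have h : ∀ n, lambertTerm q c (n + 1) = lambertTerm q (c * q) n := fun n => by
    rw [lambertTerm, lambertTerm, pow_succ' q (n + 1)]; simp only [mul_assoc]
  rw [hs.tsum_eq_zero_add, tsum_congr h, add_sub_cancel_right, lambertTerm]
  simp

/-- The telescoped partial sums; the last summand tends to `0` as `n` grows. -/
lemma sum_binomialTerm_sub (hq : ‖q‖ < 1) (hc : ‖c * q‖ < 1) (n : ℕ) :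
    ∑ k ∈ Finset.range n, (binomialTerm q c k - binomialTerm q (c * q) k) =
      c * q / (1 - c * q) +
        -(c * q * (1 - c * q)⁻¹ * ((qFall c q n * q ^ n) * (qPoch q q n)⁻¹)) := by
  have h1 := one_sub_ne_zero_of_norm_lt hc
  induction n with
  | zero => simp [qFall_zero, qPoch_zero]; ring
  | succ n ih =>
    have h2 := qPoch_ne_zero hq hq n
    have h3 : 1 - q * q ^ n ≠ 0 := one_sub_mul_pow_ne_zero hq hq n
    rw [Finset.sum_range_succ, ih, binomialTerm, binomialTerm, qFall_mul_succ, qFall_succ,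
      qPoch_succ, pow_succ' q n]
    field_simp
    ring

lemma tsum_binomialTerm_sub (hq : ‖q‖ < 1) (hc : ‖c * q‖ < 1) :
    ∑' n, binomialTerm q c n - ∑' n, binomialTerm q (c * q) n = c * q / (1 - c * q) := by
  have hs1 := (geomDominated_binomialTerm (ρ := ‖c‖) hq (by rwa [← norm_mul])).summable le_rfl
  have hs2 := (geomDominated_binomialTerm (ρ := ‖c * q‖) hq
    (by rw [← norm_mul]; exact norm_mul_self_lt hq hc)).summable le_rfl
  rw [← hs1.tsum_sub hs2]
  have hr : max 1 ‖c‖ * ‖q‖ < 1 := by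
    rw [norm_mul] at hc
    rcases max_cases 1 ‖c‖ with h | h <;> simp [h.1, hq, hc]
  refine tsum_eq_of_sum_range (hs1.sub hs2) (by positivity) hr ?_ (sum_binomialTerm_sub hq hc)
  have h1 := (isBigO_qFall (u := fun _ : ℕ => c) (k := id) hq (le_max_left 1 ‖c‖)
    fun _ => le_max_right _ _).mul (isBigO_pow_norm q id)
  have h2 := isBigO_qPoch_inv (u := fun _ : ℕ => q) (k := id) hq (fun _ => le_rfl) hq
  refine (((h1.mul h2).const_mul_left (c * q * (1 - c * q)⁻¹)).neg_left.mono le_top).congr_right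
    fun n => ?_
  simp [mul_pow]

lemma qPoch_shift_two (c q : ℂ) (n : ℕ) :
    (1 - c) * (1 - c * q) * qPoch (c * q * q) q n =
      qPoch c q n * (1 - c * q ^ n) * (1 - c * q ^ (n + 1)) := by
  have h := one_sub_mul_qPoch c q n
  rw [mul_assoc, one_sub_mul_qPoch, ← mul_assoc, h]
  ring

lemma wellPoisedTerm_eq (a q : ℂ) (n : ℕ) : wellPoisedTerm q a n =
    (1 - a * q ^ 2 * (q ^ n) ^ 2) * ((1 - a) * qPoch (a * q) q n) * (qFall a q n * (a - q ^ n)) *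
      (q * q ^ n) / ((1 - a * q * q ^ n) * (1 - q * q ^ n) * (qPoch q q n * (1 - q * q ^ n)) *
        (qPoch (a ^ 2 * q) q n * (1 - a ^ 2 * q * q ^ n))) := by
  rw [wellPoisedTerm, qPoch_succ a, ← one_sub_mul_qPoch, qFall_succ, qPoch_succ, qPoch_succ]
  congr 1 <;> ring

lemma wellPoisedTerm_mul_eq (hq : ‖q‖ < 1) (ha2 : ‖a ^ 2 * q‖ < 1) (n : ℕ) :
    wellPoisedTerm q (a * q) n =
    (1 - a * q ^ 3 * (q ^ n) ^ 2) * (qPoch (a * q) q n * (1 - a * q * q ^ n)) *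
      ((a * q - 1) * q ^ n * qFall a q n) * (q * q ^ n) *
      ((1 - a ^ 2 * q) * (1 - a ^ 2 * q ^ 2)) /
        ((1 - a * q ^ 2 * q ^ n) * (1 - q * q ^ n) * (qPoch q q n * (1 - q * q ^ n)) *
        (qPoch (a ^ 2 * q) q n * (1 - a ^ 2 * q * q ^ n) * (1 - a ^ 2 * q ^ 2 * q ^ n) *
          (1 - a ^ 2 * q ^ 3 * q ^ n))) := by
  have h2 := one_sub_ne_zero_of_norm_lt ha2
  have h3 := one_sub_ne_zero_of_norm_lt (norm_mul_self_lt hq ha2)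
  have e := qPoch_shift_two (a ^ 2 * q) q (n + 1)
  rw [qPoch_succ (a ^ 2 * q)] at e
  have e2 : qPoch ((a * q) ^ 2 * q) q (n + 1) = qPoch (a ^ 2 * q) q n *
      (1 - a ^ 2 * q * q ^ n) * (1 - a ^ 2 * q ^ 2 * q ^ n) *
      (1 - a ^ 2 * q ^ 3 * q ^ n) / ((1 - a ^ 2 * q) * (1 - a ^ 2 * q ^ 2)) := by
    rw [eq_div_iff (mul_ne_zero h2 (by simpa [pow_two, mul_assoc] using h3))]
    calc _ = (1 - a ^ 2 * q) * (1 - a ^ 2 * q * q) * qPoch (a ^ 2 * q * q * q) q (n + 1) := by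
          rw [show (a * q) ^ 2 * q = a ^ 2 * q * q * q by ring]; ring
      _ = _ := by rw [e]; ring
  rw [wellPoisedTerm, qPoch_succ (a * q), qFall_mul_succ, e2, qPoch_succ, ← mul_div_assoc,
    div_div_eq_mul_div]
  congr 1 <;> ring

/-- The telescoped partial sums. The polynomial in `q ^ n` is the numerator of the creative
telescoping certificate (found by interpolating in `q ^ n`); with it, the inductive step is an
identity of rational functions in `a`, `q` and `q ^ n`. -/
lemma sum_wellPoisedTerm_sub (hq : ‖q‖ < 1) (ha : ‖a * q‖ < 1) (ha2 : ‖a ^ 2 * q‖ < 1) (n : ℕ) :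
    ∑ k ∈ Finset.range n, (wellPoisedTerm q a k - wellPoisedTerm q (a * q) k) =
      (2 * (a * q / (1 - a * q)) - (a ^ 2 * q / (1 - a ^ 2 * q) +
        a ^ 2 * q ^ 2 / (1 - a ^ 2 * q ^ 2))) +
      (qFall a q n * q ^ n) * (qPoch (a * q) q n * (1 - a * q)⁻¹ * (1 - a * q * q ^ n)⁻¹ *
        (qPoch q q n)⁻¹ * (qPoch (a ^ 2 * q) q (n + 2))⁻¹ *
        ((a ^ 2 * q - a * q) +
          (-a + 3 * a ^ 2 * q - 3 * a ^ 4 * q ^ 2 + a ^ 5 * q ^ 3) * q * q ^ n +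
          (a ^ 5 * q ^ 2 - a ^ 4 * q ^ 2) * q ^ 2 * (q ^ n * q ^ n))) := by
  have h1 := one_sub_ne_zero_of_norm_lt ha
  have h2 := one_sub_ne_zero_of_norm_lt ha2
  have h3 : 1 - a ^ 2 * q ^ 2 ≠ 0 := by
    simpa [pow_two, mul_assoc] using one_sub_mul_pow_ne_zero hq ha2 1
  induction n with
  | zero =>
    simp only [Finset.range_zero, Finset.sum_empty, qFall_zero, qPoch_zero, qPoch_succ, pow_zero,
      mul_one, pow_one, zero_add, one_mul, inv_one]
    rw [mul_assoc (a ^ 2) q q, ← pow_two q]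
    field_simp
    ring
  | succ n ih =>
    have h4 := qPoch_ne_zero hq hq n
    have h5 : 1 - q * q ^ n ≠ 0 := one_sub_mul_pow_ne_zero hq hq n
    have h6 : 1 - a * q * q ^ n ≠ 0 := one_sub_mul_pow_ne_zero hq ha n
    have h7 : 1 - a * q ^ 2 * q ^ n ≠ 0 := by
      convert one_sub_mul_pow_ne_zero hq ha (n + 1) using 2; ring
    have h8 := qPoch_ne_zero hq ha2 n
    have h9 : 1 - a ^ 2 * q * q ^ n ≠ 0 := one_sub_mul_pow_ne_zero hq ha2 n
    have h10 : 1 - a ^ 2 * q ^ 2 * q ^ n ≠ 0 := by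
      convert one_sub_mul_pow_ne_zero hq ha2 (n + 1) using 2; ring
    have h11 : 1 - a ^ 2 * q ^ 3 * q ^ n ≠ 0 := by
      convert one_sub_mul_pow_ne_zero hq ha2 (n + 2) using 2; ring
    have e1 : qPoch (a ^ 2 * q) q (n + 2) = qPoch (a ^ 2 * q) q n *
        (1 - a ^ 2 * q * q ^ n) * (1 - a ^ 2 * q ^ 2 * q ^ n) := by
      rw [qPoch_succ, qPoch_succ]; ring
    have e2 : qPoch (a ^ 2 * q) q (n + 1 + 2) = qPoch (a ^ 2 * q) q n *
        (1 - a ^ 2 * q * q ^ n) * (1 - a ^ 2 * q ^ 2 * q ^ n) * (1 - a ^ 2 * q ^ 3 * q ^ n) := by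
      rw [show n + 1 + 2 = n + 2 + 1 from rfl, qPoch_succ, e1]; ring
    have e3 : 1 - a * q * q ^ (n + 1) = 1 - a * q ^ 2 * q ^ n := by ring
    rw [Finset.sum_range_succ, ih, wellPoisedTerm_eq, wellPoisedTerm_mul_eq hq ha2, e1, e2, e3,
      qFall_succ, qPoch_succ, qPoch_succ, pow_succ' q n]
    generalize q ^ n = x at *
    generalize qPoch (a * q) q n = P at *
    generalize qPoch (a ^ 2 * q) q n = W at *
    generalize qPoch q q n = K at *
    generalize qFall a q n = F at *
    rw [add_assoc, add_right_inj]
    clear ih e1 e2 e3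
    -- Naming the denominators keeps `field_simp` from expanding them before it cancels.
    generalize hd1 : 1 - a * q = d1 at *
    generalize hd2 : 1 - a ^ 2 * q = d2 at *
    generalize hd3 : 1 - a ^ 2 * q ^ 2 = d3 at *
    generalize hd5 : 1 - q * x = d5 at *
    generalize hd6 : 1 - a * q * x = d6 at *
    generalize hd7 : 1 - a * q ^ 2 * x = d7 at *
    generalize hd9 : 1 - a ^ 2 * q * x = d9 at *
    generalize hd10 : 1 - a ^ 2 * q ^ 2 * x = d10 at *
    generalize hd11 : 1 - a ^ 2 * q ^ 3 * x = d11 at *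
    field_simp
    subst hd1 hd2 hd3 hd5 hd6 hd7 hd9 hd10 hd11
    ring

lemma qPoch_mul_eq (ha : ‖a * q‖ < 1) (n : ℕ) :
    qPoch (a * q * q) q n = qPoch (a * q) q n * (1 - a * q * q ^ n) / (1 - a * q) := by
  rw [eq_div_iff (one_sub_ne_zero_of_norm_lt ha), ← one_sub_mul_qPoch, mul_comm]

lemma qPoch_mul_sq_eq (hq : ‖q‖ < 1) (ha2 : ‖a ^ 2 * q‖ < 1) (n : ℕ) :
    qPoch ((a * q) ^ 2 * q) q (2 * n + 2) = qPoch (a ^ 2 * q) q (2 * n + 2) *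
      (1 - a ^ 2 * q ^ 3 * (q ^ n) ^ 2) * (1 - a ^ 2 * q ^ 4 * (q ^ n) ^ 2) /
        ((1 - a ^ 2 * q) * (1 - a ^ 2 * q ^ 2)) := by
  have h2 := one_sub_ne_zero_of_norm_lt ha2
  have h3 := one_sub_ne_zero_of_norm_lt (norm_mul_self_lt hq ha2)
  rw [eq_div_iff (mul_ne_zero h2 (by simpa [pow_two, mul_assoc] using h3))]
  calc _ = (1 - a ^ 2 * q) * (1 - a ^ 2 * q * q) *
        qPoch (a ^ 2 * q * q * q) q (2 * n + 2) := by
        rw [show (a * q) ^ 2 * q = a ^ 2 * q * q * q by ring]; ring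
    _ = _ := by rw [qPoch_shift_two]; ring

lemma neg_mul_sq_pow (a q : ℂ) (n : ℕ) : (-(a * q) ^ 2) ^ n = (-a ^ 2) ^ n * (q ^ n) ^ 2 := by
  rw [← pow_mul, mul_comm n 2, pow_mul, ← mul_pow]; ring

lemma norm_sq_mul_self_lt (hq : ‖q‖ < 1) (ha2 : ‖a ^ 2 * q‖ < 1) : ‖(a * q) ^ 2 * q‖ < 1 := by
  convert norm_mul_pow_lt_one hq ha2 2 using 2; ring

lemma summable_wellPoisedTerm (hq : ‖q‖ < 1) (ha : ‖a * q‖ < 1) (ha2 : ‖a ^ 2 * q‖ < 1) :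
    Summable (wellPoisedTerm q a) :=
  (geomDominated_wellPoisedTerm (ρ := ‖a‖) hq (by rwa [← norm_mul])
    (by rwa [← norm_pow, ← norm_mul])).summable le_rfl

lemma tsum_wellPoisedTerm_sub (hq : ‖q‖ < 1) (ha : ‖a * q‖ < 1) (ha2 : ‖a ^ 2 * q‖ < 1) :
    ∑' n, wellPoisedTerm q a n - ∑' n, wellPoisedTerm q (a * q) n =
      2 * (a * q / (1 - a * q)) - (a ^ 2 * q / (1 - a ^ 2 * q) +
        a ^ 2 * q ^ 2 / (1 - a ^ 2 * q ^ 2)) := by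
  have hs1 := summable_wellPoisedTerm hq ha ha2
  have hs2 := summable_wellPoisedTerm hq (norm_mul_self_lt hq ha) (norm_sq_mul_self_lt hq ha2)
  rw [← hs1.tsum_sub hs2]
  have hr : max 1 ‖a‖ * ‖q‖ < 1 := by
    rw [norm_mul] at ha
    rcases max_cases 1 ‖a‖ with h | h <;> simp [h.1, hq, ha]
  refine tsum_eq_of_sum_range (hs1.sub hs2) (by positivity) hr ?_ (sum_wellPoisedTerm_sub hq ha ha2)
  have h1 := (isBigO_qFall (u := fun _ : ℕ => a) (k := id) hq (le_max_left 1 ‖a‖)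
    fun _ => le_max_right _ _).mul (isBigO_pow_norm q id)
  have h2 := isBigO_qPoch (u := fun _ : ℕ => a * q) (k := id) hq fun _ => le_rfl
  have h3 := isBigO_const_const (1 - a * q)⁻¹ (one_ne_zero (α := ℝ)) (⊤ : Filter ℕ)
  have h4 := isBigO_one_sub_inv (u := fun n : ℕ => a * q * q ^ n)
    (fun n => by simpa [mul_assoc, pow_succ'] using norm_mul_pow_succ_le hq le_rfl n)
    (by rwa [← norm_mul])
  have h5 := isBigO_qPoch_inv (u := fun _ : ℕ => q) (k := id) hq (fun _ => le_rfl) hq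
  have h6 := isBigO_qPoch_inv (u := fun _ : ℕ => a ^ 2 * q) (k := fun n => n + 2) hq
    (fun _ => le_rfl) ha2
  have h7 := isBigO_comp_pow hq (f := fun x => (a ^ 2 * q - a * q) +
          (-a + 3 * a ^ 2 * q - 3 * a ^ 4 * q ^ 2 + a ^ 5 * q ^ 3) * q * x +
          (a ^ 5 * q ^ 2 - a ^ 4 * q ^ 2) * q ^ 2 * (x * x)) (by fun_prop)
  refine ((h1.mono le_top).mul ((((((h2.mul h3).mul h4).mul h5).mul h6).mono le_top).mul h7)
    ).congr_right fun n => ?_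
  simp [mul_pow]

lemma gaussTerm_eq (a q : ℂ) (n : ℕ) : gaussTerm q a n =
    (1 - a * q ^ 2 * (q ^ n) ^ 2) * (qPoch (a * q) q n * qPoch q q (2 * n + 1) /
      (qPoch q q (n + 1) * qPoch (a ^ 2 * q) q (2 * n + 2))) * ((-a ^ 2) ^ n * -a ^ 2) *
      (q ^ (n * (n + 1) / 2) * (q * q ^ n)) := by
  rw [gaussTerm, triangle_succ, pow_add q (_ / 2), pow_succ' q n, pow_succ (-a ^ 2) n]
  ring

lemma gaussTerm_mul_eq (hq : ‖q‖ < 1) (ha : ‖a * q‖ < 1) (ha2 : ‖a ^ 2 * q‖ < 1) (n : ℕ) :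
    gaussTerm q (a * q) n =
    (1 - a * q ^ 3 * (q ^ n) ^ 2) * (qPoch (a * q) q n * (1 - a * q * q ^ n) / (1 - a * q) *
      qPoch q q (2 * n + 1) / (qPoch q q (n + 1) * (qPoch (a ^ 2 * q) q (2 * n + 2) *
        (1 - a ^ 2 * q ^ 3 * (q ^ n) ^ 2) * (1 - a ^ 2 * q ^ 4 * (q ^ n) ^ 2) /
          ((1 - a ^ 2 * q) * (1 - a ^ 2 * q ^ 2))))) *
      ((-a ^ 2) ^ n * -a ^ 2 * (q ^ 2 * (q ^ n) ^ 2)) * (q ^ (n * (n + 1) / 2) * (q * q ^ n)) := by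
  rw [gaussTerm_eq, qPoch_mul_eq ha, qPoch_mul_sq_eq hq ha2, neg_mul_sq_pow]
  ring

/-- The value at `a` of `B(a) - (1 - a q) B(a q) - a q B(a q ^ 2)`, where `B(a)` is the sum of
`gaussTerm q a`: with `g(a)` the first difference of `L(a ^ 2) - L(a)`, `L` the Lambert series, it
is `-a q - (g(a) + a q g(a q))`. -/
noncomputable def gaussRecurrenceValue (a q : ℂ) : ℂ :=
  -(a * q) - (a ^ 2 * q / (1 - a ^ 2 * q) + a ^ 2 * q ^ 2 / (1 - a ^ 2 * q ^ 2) -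
    a * q / (1 - a * q) + a * q * (a ^ 2 * q ^ 3 / (1 - a ^ 2 * q ^ 3) +
      a ^ 2 * q ^ 4 / (1 - a ^ 2 * q ^ 4) - a * q ^ 2 / (1 - a * q ^ 2)))

set_option maxHeartbeats 1000000 in
/-- The telescoped partial sums of the second-order recurrence. It is of the form
`E(a) + a q E(a q)` with `E(a) = B(a) - B(a q)`, which is the combination that turns the partial
theta series into a rational function. The polynomial in `q * q ^ n` is the numerator of the
certificate; no factor `1 - a q` or `1 - a q ^ 2` is left in its denominator. -/
lemma sum_gaussTerm_sub (hq : ‖q‖ < 1) (ha : ‖a * q‖ < 1) (ha2 : ‖a ^ 2 * q‖ < 1) (n : ℕ) :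
    ∑ k ∈ Finset.range n, (gaussTerm q a k - (1 - a * q) * gaussTerm q (a * q) k -
        a * q * gaussTerm q (a * q * q) k) =
      gaussRecurrenceValue a q + (-a ^ 2) ^ n * q ^ n * (q ^ (n * (n + 1) / 2) *
        qPoch (a * q) q n * qPoch q q (2 * n + 1) * (qPoch q q (n + 1))⁻¹ *
        (qPoch (a ^ 2 * q) q (2 * n + 4))⁻¹ *
        (q * (a ^ 2 - a ^ 4 * q * (q * q ^ n) +
          (-a ^ 2 - a ^ 3 - a ^ 4 * q ^ 2 + a ^ 5 * q) * (q * q ^ n) ^ 2 +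
          (a ^ 3 + a ^ 4 * q + a ^ 4 * q ^ 2 - a ^ 5 * q + a ^ 5 * q ^ 3 - a ^ 7 * q ^ 4) *
            (q * q ^ n) ^ 3 +
          (-a ^ 5 * q ^ 3 + a ^ 7 * q ^ 4 + a ^ 8 * q ^ 4) * (q * q ^ n) ^ 4 -
          a ^ 8 * q ^ 4 * (q * q ^ n) ^ 5))) := by
  have h1 := one_sub_ne_zero_of_norm_lt ha
  have h1' : 1 - a * q ^ 2 ≠ 0 := by
    convert one_sub_mul_pow_ne_zero hq ha 1 using 2; ring
  have h2 := one_sub_ne_zero_of_norm_lt ha2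
  have h3 : 1 - a ^ 2 * q ^ 2 ≠ 0 := by
    convert one_sub_mul_pow_ne_zero hq ha2 1 using 2; ring
  have h3' : 1 - a ^ 2 * q ^ 3 ≠ 0 := by
    convert one_sub_mul_pow_ne_zero hq ha2 2 using 2; ring
  have h3'' : 1 - a ^ 2 * q ^ 4 ≠ 0 := by
    convert one_sub_mul_pow_ne_zero hq ha2 3 using 2; ring
  induction n with
  | zero =>
    have h4 : 1 - q ≠ 0 := one_sub_ne_zero_of_norm_lt hq
    have e : qPoch (a ^ 2 * q) q 4 = (1 - a ^ 2 * q) * (1 - a ^ 2 * q ^ 2) *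
        (1 - a ^ 2 * q ^ 3) * (1 - a ^ 2 * q ^ 4) := by
      simp only [qPoch_succ, qPoch_zero]; ring
    simp only [Finset.range_zero, Finset.sum_empty, mul_zero, zero_add, e, qPoch_zero, qPoch_succ,
      pow_zero, mul_one, one_mul, Nat.zero_div, gaussRecurrenceValue]
    generalize hd1 : 1 - a * q = d1 at *
    generalize hd1' : 1 - a * q ^ 2 = d1' at *
    generalize hd2 : 1 - a ^ 2 * q = d2 at *
    generalize hd3 : 1 - a ^ 2 * q ^ 2 = d3 at *
    generalize hd3' : 1 - a ^ 2 * q ^ 3 = d3' at *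
    generalize hd3'' : 1 - a ^ 2 * q ^ 4 = d3'' at *
    field_simp
    subst hd1 hd1' hd2 hd3 hd3' hd3''
    ring
  | succ n ih =>
    have h4 := qPoch_ne_zero hq hq (n + 1)
    have h5 : 1 - q ^ 2 * q ^ n ≠ 0 := by
      convert one_sub_mul_pow_ne_zero hq hq (n + 1) using 2; ring
    have h8 := qPoch_ne_zero hq ha2 (2 * n + 2)
    have h9 : 1 - a ^ 2 * q ^ 3 * (q ^ n) ^ 2 ≠ 0 := by
      convert one_sub_mul_pow_ne_zero hq ha2 (2 * n + 2) using 2; ring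
    have h10 : 1 - a ^ 2 * q ^ 4 * (q ^ n) ^ 2 ≠ 0 := by
      convert one_sub_mul_pow_ne_zero hq ha2 (2 * n + 3) using 2; ring
    have h11 : 1 - a ^ 2 * q ^ 5 * (q ^ n) ^ 2 ≠ 0 := by
      convert one_sub_mul_pow_ne_zero hq ha2 (2 * n + 4) using 2; ring
    have h12 : 1 - a ^ 2 * q ^ 6 * (q ^ n) ^ 2 ≠ 0 := by
      convert one_sub_mul_pow_ne_zero hq ha2 (2 * n + 5) using 2; ring
    have e1 : qPoch (a ^ 2 * q) q (2 * n + 4) = qPoch (a ^ 2 * q) q (2 * n + 2) *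
        (1 - a ^ 2 * q ^ 3 * (q ^ n) ^ 2) * (1 - a ^ 2 * q ^ 4 * (q ^ n) ^ 2) := by
      rw [qPoch_succ, qPoch_succ]; ring
    have e2 : qPoch (a ^ 2 * q) q (2 * (n + 1) + 4) = qPoch (a ^ 2 * q) q (2 * n + 2) *
        (1 - a ^ 2 * q ^ 3 * (q ^ n) ^ 2) * (1 - a ^ 2 * q ^ 4 * (q ^ n) ^ 2) *
        (1 - a ^ 2 * q ^ 5 * (q ^ n) ^ 2) * (1 - a ^ 2 * q ^ 6 * (q ^ n) ^ 2) := by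
      rw [show 2 * (n + 1) + 4 = 2 * n + 4 + 1 + 1 by ring, qPoch_succ, qPoch_succ, e1]; ring
    have e3 : qPoch q q (2 * (n + 1) + 1) = qPoch q q (2 * n + 1) *
        ((1 - q ^ 2 * (q ^ n) ^ 2) * (1 - q ^ 3 * (q ^ n) ^ 2)) := by
      rw [show 2 * (n + 1) + 1 = 2 * n + 1 + 1 + 1 by ring, qPoch_succ, qPoch_succ]; ring
    have e4 : qPoch q q (n + 1 + 1) = qPoch q q (n + 1) * (1 - q ^ 2 * q ^ n) := by
      rw [qPoch_succ]; ring
    have e5 : gaussTerm q (a * q * q) n =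
        (1 - a * q ^ 4 * (q ^ n) ^ 2) * (qPoch (a * q) q n * (1 - a * q * q ^ n) / (1 - a * q) *
          (1 - a * q ^ 2 * q ^ n) / (1 - a * q ^ 2) *
          qPoch q q (2 * n + 1) / (qPoch q q (n + 1) * (qPoch (a ^ 2 * q) q (2 * n + 2) *
          (1 - a ^ 2 * q ^ 3 * (q ^ n) ^ 2) * (1 - a ^ 2 * q ^ 4 * (q ^ n) ^ 2) /
          ((1 - a ^ 2 * q) * (1 - a ^ 2 * q ^ 2)) *
          (1 - a ^ 2 * q ^ 5 * (q ^ n) ^ 2) * (1 - a ^ 2 * q ^ 6 * (q ^ n) ^ 2) /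
          ((1 - a ^ 2 * q ^ 3) * (1 - a ^ 2 * q ^ 4))))) *
        ((-a ^ 2) ^ n * -a ^ 2 * (q ^ 4 * (q ^ n) ^ 4)) *
          (q ^ (n * (n + 1) / 2) * (q * q ^ n)) := by
      rw [gaussTerm_mul_eq hq (norm_mul_self_lt hq ha) (norm_sq_mul_self_lt hq ha2),
        qPoch_mul_eq ha, qPoch_mul_sq_eq hq ha2, neg_mul_sq_pow]
      ring
    rw [Finset.sum_range_succ, ih, gaussTerm_eq, gaussTerm_mul_eq hq ha ha2, e5, e1, e2, e3, e4,
      qPoch_succ (a * q), triangle_succ, pow_add q (_ / 2), pow_succ' q n, pow_succ (-a ^ 2) n]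
    clear ih e1 e2 e3 e4 e5
    generalize q ^ (n * (n + 1) / 2) = T at *
    generalize (-a ^ 2) ^ n = B at *
    generalize qPoch (a * q) q n = P at *
    generalize qPoch (a ^ 2 * q) q (2 * n + 2) = W at *
    generalize qPoch q q (n + 1) = K at *
    generalize qPoch q q (2 * n + 1) = J at *
    generalize q ^ n = x at *
    rw [add_assoc, add_right_inj]
    generalize hd1 : 1 - a * q = d1 at *
    generalize hd1' : 1 - a * q ^ 2 = d1' at *
    generalize hd2 : 1 - a ^ 2 * q = d2 at *
    generalize hd3 : 1 - a ^ 2 * q ^ 2 = d3 at *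
    generalize hd3' : 1 - a ^ 2 * q ^ 3 = d3' at *
    generalize hd3'' : 1 - a ^ 2 * q ^ 4 = d3'' at *
    generalize hd5 : 1 - q ^ 2 * x = d5 at *
    generalize hd9 : 1 - a ^ 2 * q ^ 3 * x ^ 2 = d9 at *
    generalize hd10 : 1 - a ^ 2 * q ^ 4 * x ^ 2 = d10 at *
    generalize hd11 : 1 - a ^ 2 * q ^ 5 * x ^ 2 = d11 at *
    generalize hd12 : 1 - a ^ 2 * q ^ 6 * x ^ 2 = d12 at *
    field_simp
    subst hd1 hd1' hd2 hd3 hd3' hd3'' hd5 hd9 hd10 hd11 hd12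
    ring

lemma summable_gaussTerm (hq : ‖q‖ < 1) (ha2 : ‖a ^ 2 * q‖ < 1) : Summable (gaussTerm q a) :=
  (geomDominated_gaussTerm (ρ := ‖a‖) hq (by rwa [← norm_pow, ← norm_mul])).summable le_rfl

lemma tsum_gaussTerm_sub (hq : ‖q‖ < 1) (ha : ‖a * q‖ < 1) (ha2 : ‖a ^ 2 * q‖ < 1) :
    ∑' n, gaussTerm q a n - (1 - a * q) * ∑' n, gaussTerm q (a * q) n -
      a * q * ∑' n, gaussTerm q (a * q * q) n = gaussRecurrenceValue a q := by
  have hs1 := summable_gaussTerm hq ha2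
  have hs2 := (summable_gaussTerm hq (norm_sq_mul_self_lt hq ha2)).mul_left (1 - a * q)
  have hs3 := (summable_gaussTerm hq (norm_sq_mul_self_lt hq
    (norm_sq_mul_self_lt hq ha2))).mul_left (a * q)
  rw [← tsum_mul_left, ← tsum_mul_left, ← hs1.tsum_sub hs2, ← (hs1.sub hs2).tsum_sub hs3]
  refine tsum_eq_of_sum_range (r := ‖a ^ 2 * q‖) ((hs1.sub hs2).sub hs3) (norm_nonneg _) ha2 ?_
    (sum_gaussTerm_sub hq ha ha2)
  have h1 := (isBigO_pow_norm (-a ^ 2) (id : ℕ → ℕ)).mul (isBigO_pow_norm q id)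
  have h2 := isBigO_pow_one hq fun n : ℕ => n * (n + 1) / 2
  have h3 := isBigO_qPoch (u := fun _ : ℕ => a * q) (k := id) hq fun _ => le_rfl
  have h4 := isBigO_qPoch (u := fun _ : ℕ => q) (k := fun n => 2 * n + 1) hq fun _ => le_rfl
  have h5 := isBigO_qPoch_inv (u := fun _ : ℕ => q) (k := fun n => n + 1) hq (fun _ => le_rfl) hq
  have h6 := isBigO_qPoch_inv (u := fun _ : ℕ => a ^ 2 * q) (k := fun n => 2 * n + 4) hq
    (fun _ => le_rfl) ha2
  have h7 := isBigO_comp_pow hq (f := fun x => q * (a ^ 2 - a ^ 4 * q * (q * x) +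
          (-a ^ 2 - a ^ 3 - a ^ 4 * q ^ 2 + a ^ 5 * q) * (q * x) ^ 2 +
          (a ^ 3 + a ^ 4 * q + a ^ 4 * q ^ 2 - a ^ 5 * q + a ^ 5 * q ^ 3 - a ^ 7 * q ^ 4) *
            (q * x) ^ 3 +
          (-a ^ 5 * q ^ 3 + a ^ 7 * q ^ 4 + a ^ 8 * q ^ 4) * (q * x) ^ 4 -
          a ^ 8 * q ^ 4 * (q * x) ^ 5)) (by fun_prop)
  refine ((h1.mono le_top).mul ((((((h2.mul h3).mul h4).mul h5).mul h6).mono le_top).mul h7)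
    ).congr_right fun n => ?_
  simp [mul_pow]

lemma summable_thetaLambertTerm (hq : ‖q‖ < 1) (ha : ‖a * q‖ < 1) :
    Summable (thetaLambertTerm q a) :=
  (geomDominated_thetaLambertTerm (ρ := ‖a‖) hq (norm_nonneg _)
    (by rwa [← norm_mul])).summable le_rfl

lemma summable_thetaTerm (hq : ‖q‖ < 1) (ha : ‖a * q‖ < 1) : Summable (thetaTerm q a) :=
  (geomDominated_thetaTerm (ρ := ‖a‖) hq (norm_nonneg _) (by rwa [← norm_mul])).summable le_rfl

lemma tsum_thetaLambertTerm_sub (hq : ‖q‖ < 1) (ha : ‖a * q‖ < 1) :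
    ∑' n, thetaLambertTerm q a n - ∑' n, thetaLambertTerm q (a * q) n =
      ∑' n, thetaTerm q a n := by
  rw [← (summable_thetaLambertTerm hq ha).tsum_sub
    (summable_thetaLambertTerm hq (norm_mul_self_lt hq ha))]
  refine tsum_congr fun n => ?_
  have h : 1 - q ^ (n + 1) ≠ 0 := by
    simpa [pow_succ'] using one_sub_mul_pow_ne_zero hq hq n
  rw [thetaLambertTerm, thetaLambertTerm, ← sub_div, div_eq_iff h, thetaTerm, thetaTerm,
    neg_mul_eq_neg_mul, mul_pow]
  ring

lemma tsum_thetaTerm_add (hq : ‖q‖ < 1) (ha : ‖a * q‖ < 1) :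
    ∑' n, thetaTerm q a n + a * q * ∑' n, thetaTerm q (a * q) n = -(a * q) := by
  have h : ∀ n, thetaTerm q a (n + 1) = -(a * q * thetaTerm q (a * q) n) := fun n => by
    rw [thetaTerm, thetaTerm, triangle_succ (n + 1), pow_add q (_ / 2), ← neg_mul a q,
      mul_pow]
    ring
  rw [(summable_thetaTerm hq ha).tsum_eq_zero_add, tsum_congr h, tsum_neg, tsum_mul_left]
  simp [thetaTerm]

/-! ### Descent along the orbit of the parameter -/

lemma norm_mul_pow_lt (hq : ‖q‖ < 1) (ha : ‖a * q‖ < 1) (N : ℕ) : ‖a * q ^ N * q‖ < 1 := by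
  rw [mul_right_comm]; exact norm_mul_pow_lt_one hq ha N

lemma norm_sq_mul_pow_lt (hq : ‖q‖ < 1) (ha2 : ‖a ^ 2 * q‖ < 1) (N : ℕ) :
    ‖(a * q ^ N) ^ 2 * q‖ < 1 := by
  convert norm_mul_pow_lt_one hq ha2 (2 * N) using 2; ring

lemma tendsto_lambert (hq : ‖q‖ < 1) (hc : ‖c * q‖ < 1) {p : ℂ} (hp : ‖p‖ < 1) :
    Tendsto (fun N : ℕ => ∑' n, lambertTerm q (c * p ^ N) n) atTop (𝓝 0) := by
  have h := (geomDominated_lambertTerm (ρ := ‖c‖) hq (by rwa [← norm_mul])).tendsto_tsum le_rfl hp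
    continuousAt_lambertTerm
  simpa [lambertTerm] using h

lemma tsum_lambertTerm_sq_sub (hq : ‖q‖ < 1) (ha2 : ‖a ^ 2 * q‖ < 1) :
    ∑' n, lambertTerm q (a ^ 2) n - ∑' n, lambertTerm q ((a * q) ^ 2) n =
      a ^ 2 * q / (1 - a ^ 2 * q) + a ^ 2 * q ^ 2 / (1 - a ^ 2 * q ^ 2) := by
  have h1 := tsum_lambertTerm_sub hq ha2
  have h2 := tsum_lambertTerm_sub hq (norm_mul_self_lt hq ha2)
  rw [show a ^ 2 * q * q = (a * q) ^ 2 by ring] at h2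
  rw [← mul_pow]
  linear_combination h1 + h2

lemma tendsto_lambert_sq (hq : ‖q‖ < 1) (ha2 : ‖a ^ 2 * q‖ < 1) :
    Tendsto (fun N : ℕ => ∑' n, lambertTerm q ((a * q ^ N) ^ 2) n) atTop (𝓝 0) := by
  have h := tendsto_lambert hq ha2 (p := q ^ 2)
    (by rw [norm_pow]; exact pow_lt_one₀ (norm_nonneg _) hq two_ne_zero)
  have e : ∀ N : ℕ, a ^ 2 * (q ^ 2) ^ N = (a * q ^ N) ^ 2 := fun N => by ring
  simpa only [e] using h

/-- A function invariant along the orbit `z, z q, z q ^ 2, …` equals its limit along it. -/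
lemma eq_of_invariant_of_tendsto {f : ℂ → ℂ} {z l : ℂ}
    (hf : ∀ N : ℕ, f (z * q ^ N * q) = f (z * q ^ N))
    (hl : Tendsto (fun N : ℕ => f (z * q ^ N)) atTop (𝓝 l)) : f z = l := by
  have hconst : ∀ N : ℕ, f (z * q ^ N) = f z := by
    intro N
    induction N with
    | zero => simp
    | succ N ih => rw [← ih, ← hf N, pow_succ, mul_assoc z]
  simp only [hconst] at hl
  exact tendsto_nhds_unique tendsto_const_nhds hl

lemma binomialTerm_one (q : ℂ) (n : ℕ) : binomialTerm q 1 n = 0 := by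
  simp [binomialTerm, qFall_one]

lemma wellPoisedTerm_one (q : ℂ) (n : ℕ) : wellPoisedTerm q 1 n = 0 := by
  simp [wellPoisedTerm, qFall_one]

/-- The invariant difference of the two series is evaluated at `c = 1`, where every
`binomialTerm` vanishes. -/
lemma tsum_binomialTerm (hq : ‖q‖ < 1) (hc : ‖c * q‖ < 1) :
    ∑' n, binomialTerm q c n = ∑' n, lambertTerm q c n - ∑' n, lambertTerm q 1 n := by
  have key : ∀ c : ℂ, ‖c * q‖ < 1 →
      ∑' n, binomialTerm q c n - ∑' n, lambertTerm q c n = ∑' n, binomialTerm q 0 n := by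
    intro c hc
    have h := ((geomDominated_binomialTerm (ρ := ‖c‖) hq (by rwa [← norm_mul])).tendsto_tsum
      le_rfl hq continuousAt_binomialTerm).sub (tendsto_lambert hq hc hq)
    rw [sub_zero] at h
    refine eq_of_invariant_of_tendsto (q := q)
      (f := fun c => ∑' n, binomialTerm q c n - ∑' n, lambertTerm q c n) (fun N => ?_) h
    linear_combination tsum_lambertTerm_sub hq (norm_mul_pow_lt hq hc N) -
      tsum_binomialTerm_sub hq (norm_mul_pow_lt hq hc N)
  have h1 := key 1 (by simpa using hq)
  simp only [binomialTerm_one, tsum_zero] at h1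
  linear_combination key c hc - h1

/-- The constant `∑ wellPoisedTerm q 0 n` is found from the point `a = 1`, where every
`wellPoisedTerm` vanishes. -/
lemma tsum_wellPoisedTerm (hq : ‖q‖ < 1) (ha : ‖a * q‖ < 1) (ha2 : ‖a ^ 2 * q‖ < 1) :
    ∑' n, wellPoisedTerm q a n = 2 * ∑' n, lambertTerm q a n - ∑' n, lambertTerm q (a ^ 2) n -
      ∑' n, lambertTerm q 1 n := by
  have key : ∀ a : ℂ, ‖a * q‖ < 1 → ‖a ^ 2 * q‖ < 1 →
      ∑' n, wellPoisedTerm q a n - (2 * ∑' n, lambertTerm q a n - ∑' n, lambertTerm q (a ^ 2) n) =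
        ∑' n, wellPoisedTerm q 0 n := by
    intro a ha ha2
    have h := ((geomDominated_wellPoisedTerm (ρ := ‖a‖) hq (by rwa [← norm_mul])
      (by rwa [← norm_pow, ← norm_mul])).tendsto_tsum le_rfl hq
        (continuousAt_wellPoisedTerm hq)).sub
          (((tendsto_lambert hq ha hq).const_mul 2).sub (tendsto_lambert_sq hq ha2))
    rw [mul_zero, sub_zero, sub_zero] at h
    refine eq_of_invariant_of_tendsto (q := q)
      (f := fun a => ∑' n, wellPoisedTerm q a n -
        (2 * ∑' n, lambertTerm q a n - ∑' n, lambertTerm q (a ^ 2) n)) (fun N => ?_) h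
    have h1 := tsum_wellPoisedTerm_sub hq (norm_mul_pow_lt hq ha N) (norm_sq_mul_pow_lt hq ha2 N)
    have h2 := tsum_lambertTerm_sub hq (norm_mul_pow_lt hq ha N)
    have h3 := tsum_lambertTerm_sq_sub hq (norm_sq_mul_pow_lt hq ha2 N)
    linear_combination -h1 + 2 * h2 - h3
  have h1 := key 1 (by simpa using hq) (by simpa using hq)
  simp only [wellPoisedTerm_one, tsum_zero, one_pow] at h1
  linear_combination key a ha ha2 - h1

/-- The right-hand side minus the left-hand side of the first representation. -/
noncomputable def gaussDefect (q a : ℂ) : ℂ :=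
  ∑' n, thetaLambertTerm q a n - ∑' n, gaussTerm q a n -
    (∑' n, lambertTerm q (a ^ 2) n - ∑' n, lambertTerm q a n)

lemma gaussDefect_recurrence (hq : ‖q‖ < 1) (ha : ‖a * q‖ < 1) (ha2 : ‖a ^ 2 * q‖ < 1) :
    gaussDefect q a - gaussDefect q (a * q) =
      -(a * q) * (gaussDefect q (a * q) - gaussDefect q (a * q * q)) := by
  have ha' := norm_mul_self_lt hq ha
  have ha2' := norm_sq_mul_self_lt hq ha2
  have h1 := tsum_thetaLambertTerm_sub hq ha
  have h2 := tsum_thetaLambertTerm_sub hq ha'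
  have h3 := tsum_thetaTerm_add hq ha
  have h4 := tsum_gaussTerm_sub hq ha ha2
  have h5 := tsum_lambertTerm_sub hq ha
  have h6 := tsum_lambertTerm_sub hq ha'
  have h7 := tsum_lambertTerm_sq_sub hq ha2
  have h8 := tsum_lambertTerm_sq_sub hq ha2'
  rw [show a * q * q / (1 - a * q * q) = a * q ^ 2 / (1 - a * q ^ 2) by ring] at h6
  rw [show (a * q) ^ 2 * q = a ^ 2 * q ^ 3 by ring,
    show (a * q) ^ 2 * q ^ 2 = a ^ 2 * q ^ 4 by ring] at h8
  rw [gaussRecurrenceValue] at h4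
  simp only [gaussDefect]
  linear_combination h1 + a * q * h2 + h3 - h4 + h5 + a * q * h6 - h7 - a * q * h8

lemma tendsto_gaussDefect (hq : ‖q‖ < 1) (ha : ‖a * q‖ < 1) (ha2 : ‖a ^ 2 * q‖ < 1) :
    Tendsto (fun N : ℕ => gaussDefect q (a * q ^ N)) atTop (𝓝 0) := by
  have h1 := (geomDominated_thetaLambertTerm (ρ := ‖a‖) hq (norm_nonneg _)
    (by rwa [← norm_mul])).tendsto_tsum le_rfl hq continuousAt_thetaLambertTerm
  have h2 := (geomDominated_gaussTerm (ρ := ‖a‖) hq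
    (by rwa [← norm_pow, ← norm_mul])).tendsto_tsum le_rfl hq (continuousAt_gaussTerm hq)
  simpa [gaussDefect, thetaLambertTerm, thetaTerm, gaussTerm]
    using (h1.sub h2).sub ((tendsto_lambert_sq hq ha2).sub (tendsto_lambert hq ha hq))

lemma gaussDefect_eq_zero (hq : ‖q‖ < 1) (ha : ‖a * q‖ < 1) (ha2 : ‖a ^ 2 * q‖ < 1) :
    gaussDefect q a = 0 := by
  have hstep : ∀ a : ℂ, ‖a * q‖ < 1 → ‖a ^ 2 * q‖ < 1 →
      gaussDefect q a = gaussDefect q (a * q) := by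
    intro a ha ha2
    -- The recurrence bounds each first difference by the next one, and these tend to `0`.
    have hle : ∀ N : ℕ, ‖gaussDefect q a - gaussDefect q (a * q)‖ ≤
        ‖gaussDefect q (a * q ^ N) - gaussDefect q (a * q ^ (N + 1))‖ := by
      intro N
      induction N with
      | zero => simp
      | succ N ih =>
        have hN := norm_mul_pow_lt hq ha N
        have h := gaussDefect_recurrence hq hN (norm_sq_mul_pow_lt hq ha2 N)
        simp only [mul_assoc a, ← pow_succ] at h hN
        refine ih.trans ?_
        rw [h, norm_mul, norm_neg]
        exact mul_le_of_le_one_left (norm_nonneg _) hN.le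
    have hlim := tendsto_gaussDefect hq ha ha2
    have h := (hlim.sub ((tendsto_add_atTop_iff_nat 1).mpr hlim)).norm
    rw [sub_zero, norm_zero] at h
    exact sub_eq_zero.mp (norm_le_zero_iff.mp (ge_of_tendsto' h hle))
  exact eq_of_invariant_of_tendsto
    (fun N => (hstep _ (norm_mul_pow_lt hq ha N) (norm_sq_mul_pow_lt hq ha2 N)).symm)
    (tendsto_gaussDefect hq ha ha2)

end Recurrences

/-! ### Passage from the stated terms -/

section Transfer

variable {a q : ℂ}

lemma summable_pnat_iff_succ (f : ℕ+ → ℂ) : Summable f ↔ Summable fun n : ℕ => f n.succPNat :=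
  Equiv.pnatEquivNat.symm.summable_iff.symm

lemma tsum_pnat_eq_succ (f : ℕ+ → ℂ) : ∑' n, f n = ∑' n : ℕ, f n.succPNat :=
  (Equiv.pnatEquivNat.symm.tsum_eq f).symm

lemma lambertTerm_spec (c : ℂ) (n : ℕ) :
    c * q ^ (n + 1) / (1 - c * q ^ (n + 1)) = lambertTerm q c n := rfl

lemma thetaLambertTerm_spec (n : ℕ) :
    (-a) ^ (n + 1) * q ^ ((n + 1) * (n + 1 + 1) / 2) / (1 - q ^ (n + 1)) =
      thetaLambertTerm q a n := rfl

lemma gaussTerm_spec (ha1 : a ≠ 1) (n : ℕ) :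
    (1 - a * q ^ (2 * (n + 1))) / (1 - a) *
        (qPoch a q (n + 1) * qPoch q q (2 * (n + 1) - 1) /
          (qPoch q q (n + 1) * qPoch (a ^ 2 * q) q (2 * (n + 1)))) *
        (-a ^ 2) ^ (n + 1) * q ^ ((n + 1) * (n + 1 + 1) / 2) = gaussTerm q a n := by
  have h : 1 - a ≠ 0 := sub_ne_zero.mpr ha1.symm
  rw [gaussTerm, qPoch_succ a, ← one_sub_mul_qPoch, show 2 * (n + 1) - 1 = 2 * n + 1 by omega,
    show 2 * (n + 1) = 2 * n + 2 by ring]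
  field_simp

lemma binomialTerm_spec (ha : a ≠ 0) (n : ℕ) :
    qPoch (1 / a ^ 2) q (n + 1) * a ^ (2 * (n + 1)) * q ^ (n + 1) /
      (qPoch q q (n + 1) * (1 - q ^ (n + 1))) = binomialTerm q (a ^ 2) n := by
  rw [binomialTerm, pow_mul, qPoch_one_div_mul_pow (pow_ne_zero 2 ha)]

lemma wellPoisedTerm_spec (hq : ‖q‖ < 1) (haq : ‖a * q‖ < 1) (ha : a ≠ 0) (ha1 : a ≠ 1) (n : ℕ) :
    (1 - a * q ^ (2 * (n + 1))) / (1 - a) *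
      (qPoch a q (n + 1) * qPoch a q (n + 1) * qPoch (-a * q) q (n + 1) * qPoch (1 / a) q (n + 1) *
          qPoch (q ^ 2) (q ^ 2) (n + 1 - 1) * a ^ (n + 1) * q ^ (n + 1) /
        (qPoch q q (n + 1) * qPoch q q (n + 1) * qPoch (-1) q (n + 1) *
          qPoch (q * a ^ 2) q (n + 1) * qPoch (a ^ 2 * q ^ 2) (q ^ 2) (n + 1))) = 1 / 2 * wellPoisedTerm q a n := by
  have h1 : 1 - a ≠ 0 := sub_ne_zero.mpr ha1.symm
  have h2 : 1 - a * q * q ^ n ≠ 0 := one_sub_mul_pow_ne_zero hq haq n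
  have h3 : 1 - q * q ^ n ≠ 0 := one_sub_mul_pow_ne_zero hq hq n
  have h4 := qPoch_ne_zero hq hq n
  have h5 : qPoch (-q) q n ≠ 0 := qPoch_ne_zero hq (by simpa using hq) n
  have h6 : qPoch (-(a * q)) q (n + 1) ≠ 0 := qPoch_ne_zero hq (by simpa using haq) _
  have h7 := qPoch_ne_zero hq haq n
  have e1 : qPoch (-1) q (n + 1) = 2 * qPoch (-q) q n := by
    have := one_sub_mul_qPoch (-1) q n
    rw [qPoch_succ, ← this]; norm_num
  have e2 : qPoch a q (n + 1) = (1 - a) * qPoch (a * q) q n := by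
    rw [qPoch_succ, one_sub_mul_qPoch]
  rw [wellPoisedTerm, ← qPoch_one_div_mul_pow ha, e1, e2, Nat.add_sub_cancel, qPoch_sq q q n,
    ← mul_pow a q 2, qPoch_sq, neg_mul, mul_comm q (a ^ 2), qPoch_succ (a * q), qPoch_succ q,
    pow_succ' q n, ← mul_assoc a q]
  generalize qPoch (a ^ 2 * q) q (n + 1) = W
  generalize qPoch (1 / a) q (n + 1) = U
  generalize 1 - a * q * q ^ n = d2 at *
  generalize 1 - q * q ^ n = d3 at *
  field_simp

end Transfer

theorem corollary1 (a q : ℂ) (hq : ‖q‖ < 1) (hqa : ‖q * a‖ < 1) (hqa2 : ‖q * a ^ 2‖ < 1)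
    (ha1 : a ≠ 1) :
    -- the two Lambert series converge
    (Summable fun n : ℕ+ => a ^ 2 * q ^ (n : ℕ) / (1 - a ^ 2 * q ^ (n : ℕ))) ∧
    (Summable fun n : ℕ+ => a * q ^ (n : ℕ) / (1 - a * q ^ (n : ℕ))) ∧
    -- first representation: convergence and value
    (Summable fun n : ℕ+ =>
      (-a) ^ (n : ℕ) * q ^ ((n : ℕ) * ((n : ℕ) + 1) / 2) / (1 - q ^ (n : ℕ))) ∧
    (Summable fun n : ℕ+ =>
      (1 - a * q ^ (2 * (n : ℕ))) / (1 - a) *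
        (qPoch a q n * qPoch q q (2 * (n : ℕ) - 1) /
          (qPoch q q n * qPoch (a ^ 2 * q) q (2 * (n : ℕ)))) *
        (-a ^ 2) ^ (n : ℕ) * q ^ ((n : ℕ) * ((n : ℕ) + 1) / 2)) ∧
    ((∑' n : ℕ+, a ^ 2 * q ^ (n : ℕ) / (1 - a ^ 2 * q ^ (n : ℕ))) -
        (∑' n : ℕ+, a * q ^ (n : ℕ) / (1 - a * q ^ (n : ℕ))) =
      (∑' n : ℕ+,
        (-a) ^ (n : ℕ) * q ^ ((n : ℕ) * ((n : ℕ) + 1) / 2) / (1 - q ^ (n : ℕ))) -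
      (∑' n : ℕ+,
        (1 - a * q ^ (2 * (n : ℕ))) / (1 - a) *
          (qPoch a q n * qPoch q q (2 * (n : ℕ) - 1) /
            (qPoch q q n * qPoch (a ^ 2 * q) q (2 * (n : ℕ)))) *
          (-a ^ 2) ^ (n : ℕ) * q ^ ((n : ℕ) * ((n : ℕ) + 1) / 2))) ∧
    -- second representation (its terms contain `1 / a`): convergence and value
    (a ≠ 0 →
      (Summable fun n : ℕ+ =>
        qPoch (1 / a ^ 2) q n * a ^ (2 * (n : ℕ)) * q ^ (n : ℕ) /
          (qPoch q q n * (1 - q ^ (n : ℕ)))) ∧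
      (Summable fun n : ℕ+ =>
        (1 - a * q ^ (2 * (n : ℕ))) / (1 - a) *
          (qPoch a q n * qPoch a q n * qPoch (-a * q) q n * qPoch (1 / a) q n *
              qPoch (q ^ 2) (q ^ 2) ((n : ℕ) - 1) * a ^ (n : ℕ) * q ^ (n : ℕ) /
            (qPoch q q n * qPoch q q n * qPoch (-1) q n * qPoch (q * a ^ 2) q n *
              qPoch (a ^ 2 * q ^ 2) (q ^ 2) n))) ∧
      (∑' n : ℕ+, a ^ 2 * q ^ (n : ℕ) / (1 - a ^ 2 * q ^ (n : ℕ))) -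
          (∑' n : ℕ+, a * q ^ (n : ℕ) / (1 - a * q ^ (n : ℕ))) =
        1 / 2 * (∑' n : ℕ+,
          qPoch (1 / a ^ 2) q n * a ^ (2 * (n : ℕ)) * q ^ (n : ℕ) /
            (qPoch q q n * (1 - q ^ (n : ℕ)))) -
        (∑' n : ℕ+,
          (1 - a * q ^ (2 * (n : ℕ))) / (1 - a) *
            (qPoch a q n * qPoch a q n * qPoch (-a * q) q n * qPoch (1 / a) q n *
                qPoch (q ^ 2) (q ^ 2) ((n : ℕ) - 1) * a ^ (n : ℕ) * q ^ (n : ℕ) /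
              (qPoch q q n * qPoch q q n * qPoch (-1) q n * qPoch (q * a ^ 2) q n *
                qPoch (a ^ 2 * q ^ 2) (q ^ 2) n)))) := by
  rw [mul_comm] at hqa hqa2
  have hL : ∀ {c : ℂ}, ‖c * q‖ < 1 → Summable (lambertTerm q c) := fun {c} hc =>
    (geomDominated_lambertTerm (ρ := ‖c‖) hq (by rwa [← norm_mul])).summable le_rfl
  simp only [summable_pnat_iff_succ, tsum_pnat_eq_succ, Nat.succPNat_coe, Nat.succ_eq_add_one,
    gaussTerm_spec ha1, lambertTerm_spec, thetaLambertTerm_spec]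
  refine ⟨hL hqa2, hL hqa, summable_thetaLambertTerm hq hqa, summable_gaussTerm hq hqa2, ?_,
    fun ha => ?_⟩
  · have h := gaussDefect_eq_zero hq hqa hqa2
    rw [gaussDefect] at h
    linear_combination -h
  simp only [binomialTerm_spec ha, wellPoisedTerm_spec hq hqa ha ha1]
  refine ⟨(geomDominated_binomialTerm (ρ := ‖a ^ 2‖) hq (by rwa [← norm_mul])).summable le_rfl,
    (summable_wellPoisedTerm hq hqa hqa2).mul_left (1 / 2), ?_⟩
  rw [tsum_mul_left, tsum_binomialTerm hq hqa2, tsum_wellPoisedTerm hq hqa hqa2]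
  ring
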